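/- Let $a,b\ge 0$ be integers with $a+b\neq 0$ and let $\mathbf c=(c_1,c_2,\dots)$ be a sequence of nonnegative integers. For $n\ge 1$ let $\mathfrak D^{\mathbf c}_n(a,b)$ be the set of colored Dyck paths defined as follows: its elements are the Dyck words of semilength $(a+b)n$ in the letters $u,d$ that are concatenations of the strings $P_0=d$ and $P_j=u^{(a+b)j}d^{\,b(j-1)+1}$, $j=1,\dots,n$, together with a choice, for each maximal ascent $u^{(a+b)j}$ of the word, of one of $c_j$ colors (if $c_j=0$, ascents of length $(a+b)j$ do not occur). Let $$B_{n,k}(x_1,\dots,x_{n-k+1})=\sum_{\alpha}\frac{n!}{\alpha_1!\cdots\alpha_{n-k+1}!}\prod_{j=1}^{n-k+1}\Big(\frac{x_j}{j!}\Big)^{\alpha_j}$$ be the partial Bell polynomial, the sum being over all $\alpha\in\mathbb N_0^{\,n-k+1}$ with $\sum_j\alpha_j=k$ and $\sum_j j\alpha_j=n$ (and $B_{n,k}=0$ for $k>n$). Theorem. For every $n\ge 1$ the set $\mathfrak D^{\mathbf c}_n(a,b)$ is finite, and $$\big|\mathfrak D^{\mathbf c}_n(a,b)\big|=\sum_{k=1}^n\binom{an+bk}{k-1}\frac{(k-1)!}{n!}\,B_{n,k}(1!\,c_1,2!\,c_2,\dots).$$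 Moreover, for every $k\ge1$, the number of paths in $\mathfrak D^{\mathbf c}_n(a,b)$ having exactly $k$ peaks (occurrences of $ud$) is $$\binom{an+bk}{k-1}\frac{(k-1)!}{n!}\,B_{n,k}(1!\,c_1,2!\,c_2,\dots).$$ -/

import Mathlib

open DyckStep

/-- The building blocks: `P_0 = d` and `P_j = u^((a+b)j) d^(b(j-1)+1)` for `j ≥ 1`. -/
def buildingBlock (a b : ℕ) : ℕ → List DyckStep
  | 0 => [D]
  | i + 1 => List.replicate ((a + b) * (i + 1)) U ++ List.replicate (b * i + 1) D

/-- The (uncolored) Dyck words of semilength `(a + b) n` that are concatenations of the strings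
`P_0, P_1, …, P_n`. -/
def blockDyckWords (a b n : ℕ) : Set DyckWord :=
  {w | w.semilength = (a + b) * n ∧
    ∃ js : List ℕ, (∀ j ∈ js, j ≤ n) ∧ w.toList = (js.map (buildingBlock a b)).flatten}

/-- The lengths of the maximal ascents (maximal nonempty runs of `u`'s) of a word, from left to
right: cut the word at every `d` and keep the nonempty pieces. -/
def ascentLengths (w : List DyckStep) : List ℕ :=
  ((w.splitOn D).map List.length).filter (fun m => 0 < m)

/-- The number of peaks of a word: the number of occurrences of `u` immediately followed by `d`. -/
def numPeaks (w : List DyckStep) : ℕ :=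
  (w.zip w.tail).count (U, D)

/-- The colored Dyck paths: a Dyck word of semilength `(a + b) n` built from the blocks
`P_0, …, P_n`, together with a choice, for each of its maximal ascents, of one of `c j` colors,
where `(a + b) j` is the length of the ascent. Only the values `c j` with `j ≥ 1` play a role. -/
def ColoredDyckPath (a b : ℕ) (c : ℕ → ℕ) (n : ℕ) : Type :=
  (w : blockDyckWords a b n) ×
    ((i : Fin (ascentLengths w.1.toList).length) →
      Fin (c ((ascentLengths w.1.toList).get i / (a + b))))

/-- The number of peaks of the Dyck word underlying a colored Dyck path. -/
def ColoredDyckPath.peaks {a b : ℕ} {c : ℕ → ℕ} {n : ℕ} (p : ColoredDyckPath a b c n) : ℕ :=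
  numPeaks p.1.1.toList

/-- The multi-indices `α = (α_1, …, α_(n-k+1))` of nonnegative integers with `∑ α_j = k` and
`∑ j α_j = n`; the entry `α_j` is `α i` with `j = i + 1`. All entries are automatically `≤ n`,
so that bound only serves to exhibit the set as finite. -/
def bellIndices (n k : ℕ) : Finset (Fin (n + 1 - k) → ℕ) :=
  (Fintype.piFinset fun _ => Finset.range (n + 1)).filter fun α =>
    ∑ i, α i = k ∧ ∑ i : Fin (n + 1 - k), ((i : ℕ) + 1) * α i = n

/-- The partial Bell polynomial `B_{n,k}` evaluated at `x_1, x_2, …` (`x j` stands for `x_j`);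
it is zero for `k > n`. -/
def partialBell (n k : ℕ) (x : ℕ → ℚ) : ℚ :=
  ∑ α ∈ bellIndices n k,
    ((n.factorial : ℚ) / ∏ i, ((α i).factorial : ℚ)) *
      ∏ i : Fin (n + 1 - k), (x ((i : ℕ) + 1) / (((i : ℕ) + 1).factorial : ℚ)) ^ α i

/-- The generalized Narayana number
`binom(an+bk, k-1) (k-1)!/n! B_{n,k}(1! c_1, 2! c_2, …)`, for `k ≥ 1`. -/
def generalizedNarayana (a b : ℕ) (c : ℕ → ℕ) (n k : ℕ) : ℚ :=
  ((a * n + b * k).choose (k - 1) : ℚ) * (((k - 1).factorial : ℚ) / (n.factorial : ℚ)) *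
    partialBell n k (fun j => (j.factorial : ℚ) * (c j : ℚ))

/-! A block word determines its list of block indices. Inside a block all rises precede all falls
and `P_j`, `j ≥ 1`, ends no lower than it starts. So a path is a Dyck path exactly when the coarse
walk with steps `-1` (for `P_0`) and `aj + b - 1` (for `P_j`) from `0` stays nonnegative and ends at
`0` (`isDyckFrom_blockWord`).

Fix the multiplicities `α_j` of the `P_j`, with `∑ α_j = k` and `∑ j α_j = n`. Ending at `0` forces
`z = an + bk - k` down steps. By a ballot theorem (`count_zero_succ_mul_card_arrangements`) a
proportion `1/(z + 1)` of the arrangements is admissible, which gives `(an + bk)! / ((z + 1)! ∏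
α_j!)`, that is `binom(an+bk, k-1) (k-1)! / ∏ α_j!`. Each such path has `k` peaks and `∏ c_j ^ α_j`
colorings; summing over `α` produces the Bell polynomial. -/

/-! ### Block words and their index lists -/

/-- The word obtained by concatenating the building blocks with the given indices. -/
def blockWord (a b : ℕ) (js : List ℕ) : List DyckStep :=
  (js.map (buildingBlock a b)).flatten

lemma buildingBlock_eq (a b j : ℕ) :
    buildingBlock a b j =
      List.replicate ((a + b) * j) U ++ D :: List.replicate (b * (j - 1)) D := by
  cases j <;> simp [buildingBlock, List.replicate_succ]

@[simp] lemma blockWord_nil (a b : ℕ) : blockWord a b [] = [] := rfl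

lemma blockWord_cons (a b j : ℕ) (js : List ℕ) :
    blockWord a b (j :: js) =
      List.replicate ((a + b) * j) U ++
        D :: (List.replicate (b * (j - 1)) D ++ blockWord a b js) := by
  simp [blockWord, buildingBlock_eq]

lemma replicate_U_append_D_inj {m m' : ℕ} {r r' : List DyckStep}
    (h : List.replicate m U ++ D :: r = List.replicate m' U ++ D :: r') : m = m' ∧ r = r' := by
  induction m generalizing m' with
  | zero => cases m' <;> simp_all [List.replicate_succ]
  | succ m ih =>
    cases m' with
    | zero => simp [List.replicate_succ] at h
    | succ m' =>
      simp only [List.replicate_succ, List.cons_append, List.cons.injEq, true_and] at h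
      simpa using ih h

/-- The number of `U`s before the first `D` is `(a + b) j`, which reveals the first index `j`; the
rest of that block is then known and can be cancelled. -/
lemma blockWord_injective {a b : ℕ} (hab : a + b ≠ 0) :
    Function.Injective (blockWord a b) := by
  intro js
  induction js with
  | nil => intro js' h; cases js' <;> simp_all [blockWord_cons]
  | cons j js ih =>
    intro js' h
    cases js' with
    | nil => simp [blockWord_cons] at h
    | cons j' js' =>
      rw [blockWord_cons, blockWord_cons] at h
      obtain ⟨h1, h2⟩ := replicate_U_append_D_inj h
      obtain rfl := Nat.eq_of_mul_eq_mul_left (Nat.pos_of_ne_zero hab) h1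
      rw [ih (List.append_cancel_left h2)]

lemma count_U_blockWord (a b : ℕ) (js : List ℕ) :
    (blockWord a b js).count U = (a + b) * js.sum := by
  induction js with
  | nil => simp
  | cons j js ih => simp [blockWord_cons, List.count_replicate, ih, mul_add]

/-! ### Ascents and peaks of block words -/

lemma splitOn_replicate_U_append (m : ℕ) (w : List DyckStep) :
    (List.replicate m U ++ D :: w).splitOn D = List.replicate m U :: w.splitOn D :=
  List.splitOn_append_cons_self_of_not_mem (xs := List.replicate m U) (by simp) w

lemma ascentLengths_D_cons (w : List DyckStep) : ascentLengths (D :: w) = ascentLengths w := by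
  have := splitOn_replicate_U_append 0 w
  simp only [List.replicate_zero, List.nil_append] at this
  simp [ascentLengths, this]

lemma ascentLengths_replicate_D_append (m : ℕ) (w : List DyckStep) :
    ascentLengths (List.replicate m D ++ w) = ascentLengths w := by
  induction m with
  | zero => simp
  | succ m ih => rw [List.replicate_succ, List.cons_append, ascentLengths_D_cons, ih]

lemma ascentLengths_replicate_U_append {m : ℕ} (hm : 0 < m) (w : List DyckStep) :
    ascentLengths (List.replicate m U ++ D :: w) = m :: ascentLengths w := by
  simp [ascentLengths, splitOn_replicate_U_append, hm]

/-- Every block ends in `D`, so ascents of consecutive blocks never merge. -/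
lemma ascentLengths_blockWord {a b : ℕ} (hab : a + b ≠ 0) (js : List ℕ) :
    ascentLengths (blockWord a b js) = (js.filter (0 < ·)).map ((a + b) * ·) := by
  induction js with
  | nil => simp [ascentLengths]
  | cons j js ih =>
    rw [blockWord_cons]
    rcases Nat.eq_zero_or_pos j with rfl | hj
    · simp [ascentLengths_D_cons, ih]
    · rw [ascentLengths_replicate_U_append (Nat.mul_pos (Nat.pos_of_ne_zero hab) hj),
        ascentLengths_replicate_D_append, ih, List.filter_cons_of_pos (by simpa using hj),
        List.map_cons]

lemma numPeaks_D_cons (w : List DyckStep) : numPeaks (D :: w) = numPeaks w := by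
  cases w <;> simp [numPeaks]

lemma numPeaks_replicate_D_append (m : ℕ) (w : List DyckStep) :
    numPeaks (List.replicate m D ++ w) = numPeaks w := by
  induction m with
  | zero => simp
  | succ m ih => rw [List.replicate_succ, List.cons_append, numPeaks_D_cons, ih]

lemma numPeaks_replicate_U_append (m : ℕ) (w : List DyckStep) :
    numPeaks (List.replicate (m + 1) U ++ D :: w) = numPeaks w + 1 := by
  induction m with
  | zero =>
    rw [← numPeaks_D_cons w]
    simp [numPeaks]
  | succ m ih =>
    rw [← ih]
    simp [numPeaks, List.replicate_succ]

lemma numPeaks_blockWord {a b : ℕ} (hab : a + b ≠ 0) (js : List ℕ) :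
    numPeaks (blockWord a b js) = (js.filter (0 < ·)).length := by
  induction js with
  | nil => simp [numPeaks]
  | cons j js ih =>
    rw [blockWord_cons]
    rcases Nat.eq_zero_or_pos j with rfl | hj
    · simp [numPeaks_D_cons, ih]
    · obtain ⟨m, hm⟩ := Nat.exists_eq_succ_of_ne_zero
        (Nat.mul_pos (Nat.pos_of_ne_zero hab) hj).ne'
      rw [hm, Nat.succ_eq_add_one, numPeaks_replicate_U_append, numPeaks_replicate_D_append, ih,
        List.filter_cons_of_pos (by simpa using hj), List.length_cons]

/-! ### From Dyck paths to walks with one step per block -/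

/-- The path with steps `U = +1`, `D = -1` started at height `h` stays nonnegative and ends
at height `0`. -/
def IsDyckFrom (h : ℕ) (w : List DyckStep) : Prop :=
  h + w.count U = w.count D ∧ ∀ i, (w.take i).count D ≤ h + (w.take i).count U

lemma isDyckFrom_nil {h : ℕ} : IsDyckFrom h [] ↔ h = 0 := by
  simp [IsDyckFrom]

lemma isDyckFrom_U_cons {h : ℕ} {w : List DyckStep} :
    IsDyckFrom h (U :: w) ↔ IsDyckFrom (h + 1) w := by
  refine and_congr (by simp; omega) ⟨fun H i => ?_, fun H i => ?_⟩
  · have := H (i + 1)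
    simp at this; omega
  · cases i with
    | zero => simp
    | succ i => have := H i; simp; omega

lemma isDyckFrom_D_cons {h : ℕ} {w : List DyckStep} :
    IsDyckFrom h (D :: w) ↔ 1 ≤ h ∧ IsDyckFrom (h - 1) w := by
  constructor
  · rintro ⟨h1, h2⟩
    have h0 := h2 1
    simp at h0
    refine ⟨h0, by simp at h1; omega, fun i => ?_⟩
    have := h2 (i + 1)
    simp at this; omega
  · rintro ⟨h0, h1, h2⟩
    refine ⟨by simp; omega, fun i => ?_⟩
    cases i with
    | zero => simp
    | succ i => have := h2 i; simp; omega

lemma isDyckFrom_replicate_U_append {h m : ℕ} {w : List DyckStep} :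
    IsDyckFrom h (List.replicate m U ++ w) ↔ IsDyckFrom (h + m) w := by
  induction m generalizing h with
  | zero => simp
  | succ m ih =>
    rw [List.replicate_succ, List.cons_append, isDyckFrom_U_cons, ih, add_right_comm, add_assoc]

lemma isDyckFrom_replicate_D_append {h m : ℕ} {w : List DyckStep} :
    IsDyckFrom (h + m) (List.replicate m D ++ w) ↔ IsDyckFrom h w := by
  induction m generalizing h with
  | zero => simp
  | succ m ih =>
    rw [List.replicate_succ, List.cons_append, isDyckFrom_D_cons, ← add_assoc,
      Nat.add_sub_cancel, ih]
    simp

/-- The walk started at height `h` whose letters `0` are steps `-1` and whose letters `x ≠ 0`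
are steps `g x` stays nonnegative and ends at height `0`. -/
def StaysNonneg (g : ℕ → ℕ) : ℕ → List ℕ → Prop
  | h, [] => h = 0
  | h, x :: l => if x = 0 then 1 ≤ h ∧ StaysNonneg g (h - 1) l else StaysNonneg g (h + g x) l

/-- The increment in height of a nonempty building block. -/
def blockRise (a b j : ℕ) : ℕ := if j = 0 then 0 else a * j + b - 1

lemma isDyckFrom_blockWord {a b : ℕ} (hab : a + b ≠ 0) (h : ℕ) (js : List ℕ) :
    IsDyckFrom h (blockWord a b js) ↔ StaysNonneg (blockRise a b) h js := by
  induction js generalizing h with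
  | nil => simp [isDyckFrom_nil, StaysNonneg]
  | cons j js ih =>
    rw [blockWord_cons, StaysNonneg]
    split_ifs with hj
    · subst hj
      simp [isDyckFrom_D_cons, ih]
    · obtain ⟨i, rfl⟩ := Nat.exists_eq_succ_of_ne_zero hj
      -- The peak of the block lies `b * i + 1` above its final height, so the final descent never
      -- goes below zero.
      have key : h + (a + b) * (i + 1) = h + blockRise a b (i + 1) + (b * i + 1) := by
        have : 1 ≤ a * (i + 1) + b := by
          rcases Nat.eq_zero_or_pos a with rfl | ha
          · omega
          · exact le_add_right (Nat.mul_pos ha (Nat.succ_pos i))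
        have e : (a + b) * (i + 1) = a * (i + 1) + b + b * i := by ring
        simp only [blockRise, Nat.succ_ne_zero, if_false]
        omega
      have e : D :: (List.replicate (b * (i + 1 - 1)) D ++ blockWord a b js) =
          List.replicate (b * i + 1) D ++ blockWord a b js := by
        simp [List.replicate_succ]
      rw [Nat.succ_eq_add_one, e, isDyckFrom_replicate_U_append, key,
        isDyckFrom_replicate_D_append, ih]

/-- The index lists of the words in `blockDyckWords a b n`. -/
def blockIndexLists (a b n : ℕ) : Set (List ℕ) :=
  {js | js.sum = n ∧ StaysNonneg (blockRise a b) 0 js}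

lemma isDyckFrom_zero_toList (w : DyckWord) : IsDyckFrom 0 w.toList :=
  ⟨by rw [zero_add, w.count_U_eq_count_D], fun i => by
    rw [zero_add]; exact w.count_D_le_count_U i⟩

/-- Words in `blockDyckWords a b n` correspond to their index lists. -/
noncomputable def blockDyckWordsEquiv {a b : ℕ} (hab : a + b ≠ 0) (n : ℕ) :
    blockIndexLists a b n ≃ blockDyckWords a b n :=
  Equiv.ofBijective
    (fun js =>
      have hd := (isDyckFrom_blockWord hab 0 js.1).2 js.2.2
      ⟨⟨blockWord a b js.1, by simpa using hd.1, fun i => by simpa using hd.2 i⟩, by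
        refine ⟨?_, js.1, fun j hj => ?_, rfl⟩
        · rw [DyckWord.semilength]
          exact (count_U_blockWord a b js.1).trans (by rw [js.2.1])
        · exact (List.single_le_sum (fun _ _ => Nat.zero_le _) j hj).trans js.2.1.le⟩)
    (by
      constructor
      · intro js js' h
        exact Subtype.ext (blockWord_injective hab
          (congrArg (fun w : blockDyckWords a b n => w.1.toList) h))
      · rintro ⟨w, hw, js, -, hjs⟩
        have hjs' : w.toList = blockWord a b js := hjs
        refine ⟨⟨js, ?_, ?_⟩, ?_⟩
        · rw [DyckWord.semilength, hjs', count_U_blockWord] at hw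
          exact Nat.eq_of_mul_eq_mul_left (Nat.pos_of_ne_zero hab) hw
        · rw [← isDyckFrom_blockWord hab, ← hjs']
          exact isDyckFrom_zero_toList w
        · exact Subtype.ext (DyckWord.ext hjs'.symm))

lemma blockDyckWordsEquiv_toList {a b : ℕ} (hab : a + b ≠ 0) (n : ℕ)
    (js : blockIndexLists a b n) :
    (blockDyckWordsEquiv hab n js).1.toList = blockWord a b js.1 := rfl

lemma finite_blockDyckWords (a b n : ℕ) : Finite (blockDyckWords a b n) :=
  Finite.of_injective
    (fun w => (⟨w.1, w.2.1⟩ : {p : DyckWord // p.semilength = (a + b) * n}))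
    fun _ _ h => Subtype.ext (congrArg (fun p => p.1) h)

/-! ### The ballot theorem -/

open scoped Classical in
/-- The arrangements of the letters of `M` forming a walk from height `h` that stays
nonnegative and ends at `0`. -/
noncomputable def arrangements (g : ℕ → ℕ) (h : ℕ) (M : Multiset ℕ) : Finset (List ℕ) :=
  M.lists.toFinset.filter (StaysNonneg g h)

lemma mem_arrangements {g : ℕ → ℕ} {h : ℕ} {M : Multiset ℕ} {l : List ℕ} :
    l ∈ arrangements g h M ↔ (l : Multiset ℕ) = M ∧ StaysNonneg g h l := by
  simp [arrangements, Multiset.mem_lists_iff, eq_comm]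

-- Classification by the first letter, the recursion that drives the ballot theorem.
open scoped Classical in
lemma card_arrangements {g : ℕ → ℕ} {h : ℕ} {M : Multiset ℕ} (hM : M ≠ 0) :
    (arrangements g h M).card = ∑ x ∈ M.toFinset,
      if x = 0 then (if h = 0 then 0 else (arrangements g (h - 1) (M.erase 0)).card)
      else (arrangements g (h + g x) (M.erase x)).card := by
  have hU : arrangements g h M = M.toFinset.biUnion fun x =>
      (if x = 0 then (if h = 0 then ∅ else arrangements g (h - 1) (M.erase 0))
        else arrangements g (h + g x) (M.erase x)).map ⟨List.cons x, List.cons_injective⟩ := by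
    ext l
    simp only [mem_arrangements, Finset.mem_biUnion, Finset.mem_map,
      Function.Embedding.coeFn_mk, Multiset.mem_toFinset]
    constructor
    · rintro ⟨rfl, hl⟩
      cases l with
      | nil => exact absurd rfl hM
      | cons x l =>
        refine ⟨x, by simp, l, ?_, rfl⟩
        rw [StaysNonneg] at hl
        split_ifs at hl ⊢ with h1 h2
        · omega
        · subst h1; exact mem_arrangements.2 ⟨by simp, hl.2⟩
        · exact mem_arrangements.2 ⟨by simp, hl⟩
    · rintro ⟨x, hx, l, hl, rfl⟩
      rw [StaysNonneg]
      split_ifs at hl ⊢ with h1 h2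
      · simp at hl
      · subst h1
        obtain ⟨e, hl⟩ := mem_arrangements.1 hl
        exact ⟨by rw [← Multiset.cons_coe, e, Multiset.cons_erase hx], by omega, hl⟩
      · obtain ⟨e, hl⟩ := mem_arrangements.1 hl
        exact ⟨by rw [← Multiset.cons_coe, e, Multiset.cons_erase hx], hl⟩
  rw [hU, Finset.card_biUnion]
  · refine Finset.sum_congr rfl fun x _ => ?_
    rw [Finset.card_map]
    split_ifs <;> simp
  · intro x _ y _ hxy
    refine Finset.disjoint_left.2 fun l hx hy => hxy ?_
    obtain ⟨_, _, rfl⟩ := Finset.mem_map.1 hx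
    obtain ⟨_, _, e⟩ := Finset.mem_map.1 hy
    exact (List.cons.inj e).1.symm

lemma prod_factorial_count_erase {M : Multiset ℕ} {x : ℕ} (hx : x ∈ M) :
    ∏ y ∈ M.toFinset, (M.count y).factorial =
      M.count x * ∏ y ∈ (M.erase x).toFinset, ((M.erase x).count y).factorial := by
  have hsub : (M.erase x).toFinset ⊆ M.toFinset := fun y hy => by
    rw [Multiset.mem_toFinset] at hy ⊢
    exact Multiset.mem_of_mem_erase hy
  rw [Finset.prod_subset hsub (fun y _ hy => by
    rw [Multiset.mem_toFinset] at hy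
    rw [Multiset.count_eq_zero_of_notMem hy, Nat.factorial_zero])]
  have hx' := Multiset.mem_toFinset.2 hx
  rw [← Finset.mul_prod_erase _ _ hx', ← Finset.mul_prod_erase _ _ hx', ← mul_assoc,
    Multiset.count_erase_self, Nat.mul_factorial_pred (Multiset.count_pos.2 hx).ne']
  congr 1
  exact Finset.prod_congr rfl fun y hy => by
    rw [Multiset.count_erase_of_ne (Finset.ne_of_mem_erase hy)]

/-- A weighted ballot theorem: the arrangements of `M` starting at height `h` are a proportion
`(h + 1) / (z + 1)` of all arrangements, `z` being the number of down steps. -/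
theorem count_zero_succ_mul_card_arrangements (g : ℕ → ℕ) (hg : g 0 = 0) (M : Multiset ℕ)
    (h : ℕ) (hM : h + (M.map g).sum = M.count 0) :
    (M.count 0 + 1) * (arrangements g h M).card * ∏ x ∈ M.toFinset, (M.count x).factorial =
      (h + 1) * (Multiset.card M).factorial := by
  obtain ⟨N, hN⟩ : ∃ N, Multiset.card M = N := ⟨_, rfl⟩
  induction N generalizing M h with
  | zero =>
    obtain rfl := Multiset.card_eq_zero.1 hN
    obtain rfl : h = 0 := by simpa using hM
    have : arrangements g 0 0 = {[]} := by
      ext l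
      rw [mem_arrangements, Finset.mem_singleton, Multiset.coe_eq_zero]
      constructor
      · exact fun H => H.1
      · rintro rfl; exact ⟨rfl, rfl⟩
    simp [this]
  | succ N ih =>
    have hM0 : M ≠ 0 := by rintro rfl; simp at hN
    have herase : ∀ x ∈ M, Multiset.card (M.erase x) = N := fun x hx => by
      rw [Multiset.card_erase_of_mem hx, hN]; rfl
    have hsum : ∀ x ∈ M, g x + ((M.erase x).map g).sum = (M.map g).sum := fun x hx => by
      conv_rhs => rw [← Multiset.cons_erase hx]
      simp
    set S := (M.map g).sum with hS
    set z := M.count 0 with hz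
    -- The contribution of first letter `x`, by induction. Adding `S * N!` when `x = 0` makes the
    -- right side uniform in `x`: a down step gives `(z + 1) * h`, and `(z + 1) * h + S = z * (h +
    -- 1)` because `z = h + S`.
    have hterm : ∀ x ∈ M.toFinset,
        (z + 1) * (if x = 0 then (if h = 0 then 0 else (arrangements g (h - 1) (M.erase 0)).card)
          else (arrangements g (h + g x) (M.erase x)).card) *
          (∏ x ∈ M.toFinset, (M.count x).factorial) + (if x = 0 then S else 0) * N.factorial =
        M.count x * (h + 1 + g x) * N.factorial := by
      intro x hx
      rw [Multiset.mem_toFinset] at hx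
      rw [prod_factorial_count_erase hx]
      have hc := Multiset.count_pos.2 hx
      split_ifs with h1 h2
      · subst h1 h2
        rw [← hz, hg]
        simp only [zero_add] at hM ⊢
        rw [hM]; ring
      · subst h1
        obtain ⟨h, rfl⟩ := Nat.exists_eq_succ_of_ne_zero h2
        have := ih (M.erase 0) h (by
          have := hsum 0 hx
          rw [Multiset.count_erase_self]; omega) (herase 0 hx)
        rw [Multiset.count_erase_self, herase 0 hx, ← hz, Nat.sub_add_cancel hc] at this
        rw [← hz, hg, Nat.succ_eq_add_one, Nat.add_sub_cancel]
        calc _ = (z + 1) * (z * (arrangements g h (M.erase 0)).card *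
              ∏ y ∈ (M.erase 0).toFinset, ((M.erase 0).count y).factorial)
                + S * N.factorial := by ring
          _ = ((z + 1) * (h + 1) + S) * N.factorial := by rw [this]; ring
          _ = _ := by rw [← hM, Nat.succ_eq_add_one]; ring
      · have hz' : (M.erase x).count 0 = z := Multiset.count_erase_of_ne (Ne.symm h1) M
        have := ih (M.erase x) (h + g x) (by
          have := hsum x hx
          rw [hz']; omega) (herase x hx)
        rw [hz', herase x hx] at this
        calc _ = M.count x * ((z + 1) * (arrangements g (h + g x) (M.erase x)).card *
              ∏ y ∈ (M.erase x).toFinset, ((M.erase x).count y).factorial) := by ring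
          _ = _ := by rw [this]; ring
    have htotal := Finset.sum_congr (rfl : M.toFinset = M.toFinset) hterm
    rw [Finset.sum_add_distrib, ← Finset.sum_mul, ← Finset.mul_sum, ← card_arrangements hM0,
      ← Finset.sum_mul, ← Finset.sum_mul] at htotal
    -- If `0` is not a letter, then `z = 0`, which forces `S = 0`.
    have hS1 : ∑ x ∈ M.toFinset, (if x = 0 then S else 0) = S := by
      rw [Finset.sum_ite_eq']
      split_ifs with h0
      · rfl
      · rw [Multiset.mem_toFinset, ← Multiset.count_eq_zero] at h0
        omega
    have hS2 : ∑ x ∈ M.toFinset, M.count x * (h + 1 + g x) = (h + 1) * (N + 1) + S := by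
      simp only [mul_add (Multiset.count _ M) (h + 1)]
      rw [Finset.sum_add_distrib, ← Finset.sum_mul, Multiset.toFinset_sum_count_eq, hN, hS,
        Finset.sum_multiset_map_count]
      simp only [smul_eq_mul]
      ring
    rw [hS1, hS2, add_mul _ S] at htotal
    rw [hN, Nat.factorial_succ, ← mul_assoc]
    exact Nat.add_right_cancel htotal

/-! ### Multisets of block indices and Bell multi-indices -/

lemma blockRise_zero (a b : ℕ) : blockRise a b 0 = 0 := rfl

/-- The balance of rises and falls: the nonzero letters determine the number of zeros. -/
lemma StaysNonneg.sum_eq {g : ℕ → ℕ} (hg : g 0 = 0) {h : ℕ} {l : List ℕ}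
    (hl : StaysNonneg g h l) : h + (l.map g).sum = l.count 0 := by
  induction l generalizing h with
  | nil => simpa [StaysNonneg] using hl
  | cons x l ih =>
    rw [StaysNonneg] at hl
    split_ifs at hl with hx
    · subst hx
      have := ih hl.2
      simp [hg]; omega
    · have := ih hl
      simp [hx]; omega

lemma Multiset.sum_map_eq_sum_fin {M : Multiset ℕ} {m : ℕ} (hM : ∀ x ∈ M, x ≤ m) (f : ℕ → ℕ) :
    (M.map f).sum = ∑ i : Fin m, M.count ((i : ℕ) + 1) * f (i + 1) + M.count 0 * f 0 := by
  rw [Fin.sum_univ_eq_sum_range (fun i => M.count (i + 1) * f (i + 1)),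
    ← Finset.sum_range_succ' (fun i => M.count i * f i), Finset.sum_multiset_map_count]
  refine Finset.sum_subset (fun x hx => ?_) fun x _ hx => ?_
  · have := hM x (Multiset.mem_toFinset.1 hx)
    simp; omega
  · rw [Multiset.mem_toFinset] at hx
    simp [Multiset.count_eq_zero_of_notMem hx]

lemma Multiset.prod_map_eq_prod_fin {M : Multiset ℕ} {m : ℕ} (hM : ∀ x ∈ M, x ≤ m) (f : ℕ → ℕ) :
    (M.map f).prod = (∏ i : Fin m, f (i + 1) ^ M.count ((i : ℕ) + 1)) * f 0 ^ M.count 0 := by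
  rw [Fin.prod_univ_eq_prod_range (fun i => f (i + 1) ^ M.count (i + 1)),
    ← Finset.prod_range_succ' (fun i => f i ^ M.count i), Finset.prod_multiset_map_count]
  refine Finset.prod_subset (fun x hx => ?_) fun x _ hx => ?_
  · have := hM x (Multiset.mem_toFinset.1 hx)
    simp; omega
  · rw [Multiset.mem_toFinset] at hx
    simp [Multiset.count_eq_zero_of_notMem hx]

lemma Multiset.prod_factorial_count_eq {M : Multiset ℕ} {m : ℕ} (hM : ∀ x ∈ M, x ≤ m) :
    ∏ x ∈ M.toFinset, (M.count x).factorial =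
      (∏ i : Fin m, (M.count ((i : ℕ) + 1)).factorial) * (M.count 0).factorial := by
  rw [Fin.prod_univ_eq_prod_range (fun i => (M.count (i + 1)).factorial),
    ← Finset.prod_range_succ' (fun i => (M.count i).factorial)]
  refine Finset.prod_subset (fun x hx => ?_) fun x _ hx => ?_
  · have := hM x (Multiset.mem_toFinset.1 hx)
    simp; omega
  · rw [Multiset.mem_toFinset] at hx
    simp [Multiset.count_eq_zero_of_notMem hx]

/-- The multiset with `z` zeros and `α i` copies of `i + 1`. -/
def multisetOfCounts {m : ℕ} (z : ℕ) (α : Fin m → ℕ) : Multiset ℕ :=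
  Multiset.replicate z 0 + ∑ i : Fin m, Multiset.replicate (α i) ((i : ℕ) + 1)

lemma count_zero_multisetOfCounts {m : ℕ} (z : ℕ) (α : Fin m → ℕ) :
    (multisetOfCounts z α).count 0 = z := by
  simp [multisetOfCounts, Multiset.count_sum', Multiset.count_replicate]

lemma count_succ_multisetOfCounts {m : ℕ} (z : ℕ) (α : Fin m → ℕ) (i : Fin m) :
    (multisetOfCounts z α).count ((i : ℕ) + 1) = α i := by
  simp [multisetOfCounts, Multiset.count_sum', Multiset.count_replicate, Fin.val_inj]

lemma le_of_mem_multisetOfCounts {m : ℕ} {z : ℕ} {α : Fin m → ℕ} {x : ℕ}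
    (hx : x ∈ multisetOfCounts z α) : x ≤ m := by
  rw [multisetOfCounts, Multiset.mem_add, Multiset.mem_sum] at hx
  rcases hx with hx | ⟨i, -, hx⟩
  · rw [Multiset.eq_of_mem_replicate hx]; exact Nat.zero_le _
  · rw [Multiset.eq_of_mem_replicate hx]; exact i.2

lemma card_multisetOfCounts {m : ℕ} (z : ℕ) (α : Fin m → ℕ) :
    Multiset.card (multisetOfCounts z α) = z + ∑ i, α i := by
  simp [multisetOfCounts]

lemma eq_multisetOfCounts {M : Multiset ℕ} {m : ℕ} (hM : ∀ x ∈ M, x ≤ m) :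
    M = multisetOfCounts (M.count 0) (fun i : Fin m => M.count ((i : ℕ) + 1)) := by
  ext x
  rcases Nat.eq_zero_or_pos x with rfl | hx
  · rw [count_zero_multisetOfCounts]
  · obtain ⟨y, rfl⟩ := Nat.exists_eq_succ_of_ne_zero hx.ne'
    by_cases hy : y < m
    · exact (count_succ_multisetOfCounts _ (fun i : Fin m => M.count ((i : ℕ) + 1)) ⟨y, hy⟩).symm
    · rw [Multiset.count_eq_zero_of_notMem fun h => hy (hM _ h),
        Multiset.count_eq_zero_of_notMem fun h => hy (le_of_mem_multisetOfCounts h)]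

/-- The number of nonzero entries of a list. -/
def numPos (l : List ℕ) : ℕ := (l.filter (0 < ·)).length

/-- The number of colorings of the nonzero entries of a list. -/
def colorings (c : ℕ → ℕ) (l : List ℕ) : ℕ := ((l.filter (0 < ·)).map c).prod

lemma numPos_eq_sum (l : List ℕ) :
    numPos l = ((l : Multiset ℕ).map fun x => if x = 0 then 0 else 1).sum := by
  induction l with
  | nil => simp [numPos]
  | cons x l ih =>
    rcases Nat.eq_zero_or_pos x with rfl | hx
    · simpa [numPos] using ih
    · simp only [numPos, Multiset.map_coe, Multiset.sum_coe] at ih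
      simp [numPos, hx, hx.ne', ih, add_comm]

lemma colorings_eq_prod (c : ℕ → ℕ) (l : List ℕ) :
    colorings c l = ((l : Multiset ℕ).map fun x => if x = 0 then 1 else c x).prod := by
  induction l with
  | nil => simp [colorings]
  | cons x l ih =>
    rcases Nat.eq_zero_or_pos x with rfl | hx
    · simpa [colorings] using ih
    · simp only [colorings, Multiset.map_coe, Multiset.prod_coe] at ih
      simp [colorings, hx, hx.ne', ih]

lemma numPos_le_sum (l : List ℕ) : numPos l ≤ l.sum := by
  induction l with
  | nil => simp [numPos]
  | cons x l ih =>
    simp only [numPos, List.filter_cons] at ih ⊢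
    split_ifs with h <;> simp at h ⊢ <;> omega

/-- If `x` is positive, the other `numPos l - 1` positive entries contribute at least `1` each. With
sum `n` and `k` positive entries, all entries are at most `n + 1 - k`, the index range of the Bell
polynomial. -/
lemma add_numPos_le_sum_add_one {l : List ℕ} {x : ℕ} (hx : x ∈ l) :
    x + numPos l ≤ l.sum + 1 := by
  induction l with
  | nil => simp at hx
  | cons y l ih =>
    have := numPos_le_sum l
    simp only [numPos, List.filter_cons] at ih this ⊢
    rcases List.mem_cons.1 hx with rfl | hx
    · split_ifs <;> simp <;> omega
    · have := ih hx
      split_ifs with h <;> simp at h ⊢ <;> omega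

lemma numPos_pos {l : List ℕ} (h : 0 < l.sum) : 0 < numPos l := by
  by_contra H
  have h0 : ∀ x ∈ l, x = 0 := by simpa [numPos] using H
  rw [List.sum_eq_zero h0] at h
  exact h.false

lemma mem_bellIndices {n k : ℕ} {α : Fin (n + 1 - k) → ℕ} :
    α ∈ bellIndices n k ↔
      ∑ i, α i = k ∧ ∑ i : Fin (n + 1 - k), ((i : ℕ) + 1) * α i = n := by
  simp only [bellIndices, Finset.mem_filter, Fintype.mem_piFinset, Finset.mem_range,
    and_iff_right_iff_imp]
  rintro ⟨-, h⟩ i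
  have h1 := Finset.single_le_sum (f := fun i : Fin (n + 1 - k) => ((i : ℕ) + 1) * α i)
    (fun _ _ => Nat.zero_le _) (Finset.mem_univ i)
  rw [h] at h1
  have h2 := Nat.le_mul_of_pos_left (α i) (Nat.succ_pos (i : ℕ))
  exact Nat.lt_succ_of_le (h2.trans h1)

/-! ### Counting index lists with given multiplicities -/

lemma blockRise_succ_add_one {a b : ℕ} (hab : a + b ≠ 0) (i : ℕ) :
    blockRise a b (i + 1) + 1 = a * (i + 1) + b := by
  rw [blockRise, if_neg (Nat.succ_ne_zero i)]
  refine Nat.sub_add_cancel ?_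
  rcases Nat.eq_zero_or_pos a with rfl | ha
  · omega
  · exact le_add_right (Nat.mul_pos ha (Nat.succ_pos i))

/-- The total rise is the number of `P_0` blocks; this form also gives `k ≤ a * n + b * k`, so the
later subtraction of `k` is not truncated. -/
lemma sum_blockRise_add {a b : ℕ} (hab : a + b ≠ 0) {n k : ℕ} {α : Fin (n + 1 - k) → ℕ}
    (hα : α ∈ bellIndices n k) :
    ∑ i : Fin (n + 1 - k), α i * blockRise a b (i + 1) + k = a * n + b * k := by
  obtain ⟨h1, h2⟩ := mem_bellIndices.1 hα
  calc _ = ∑ i : Fin (n + 1 - k), (α i * blockRise a b (i + 1) + α i) := by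
        rw [Finset.sum_add_distrib, h1]
    _ = ∑ i : Fin (n + 1 - k), (a * (((i : ℕ) + 1) * α i) + b * α i) :=
        Finset.sum_congr rfl fun i _ => by
          rw [← Nat.mul_succ, Nat.succ_eq_add_one, blockRise_succ_add_one hab]; ring
    _ = _ := by rw [Finset.sum_add_distrib, ← Finset.mul_sum, ← Finset.mul_sum, h1, h2]

lemma mem_arrangements_multisetOfCounts {a b : ℕ} (hab : a + b ≠ 0) {n k : ℕ}
    {α : Fin (n + 1 - k) → ℕ} (hα : α ∈ bellIndices n k) (l : List ℕ) :
    l ∈ arrangements (blockRise a b) 0 (multisetOfCounts (a * n + b * k - k) α) ↔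
      (l ∈ blockIndexLists a b n ∧ numPos l = k) ∧
        (fun i : Fin (n + 1 - k) => l.count ((i : ℕ) + 1)) = α := by
  have hr := sum_blockRise_add hab hα
  rw [mem_arrangements]
  constructor
  · rintro ⟨h1, h2⟩
    have hle : ∀ x ∈ (l : Multiset ℕ), x ≤ n + 1 - k := fun x hx =>
      le_of_mem_multisetOfCounts (h1 ▸ hx)
    have hc : ∀ i : Fin (n + 1 - k), (l : Multiset ℕ).count ((i : ℕ) + 1) = α i := fun i => by
      rw [h1, count_succ_multisetOfCounts]
    have hα' := mem_bellIndices.1 hα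
    refine ⟨⟨⟨?_, h2⟩, ?_⟩, funext fun i => ?_⟩
    · have := Multiset.sum_map_eq_sum_fin hle id
      simp only [hc, id, Multiset.map_id', Multiset.sum_coe] at this
      rw [mul_zero, add_zero] at this
      refine (this.trans ?_).trans hα'.2
      exact Finset.sum_congr rfl fun i _ => mul_comm _ _
    · rw [numPos_eq_sum, Multiset.sum_map_eq_sum_fin hle]
      simpa [hc] using hα'.1
    · rw [← hc i, Multiset.coe_count]
  · rintro ⟨⟨⟨h1, h2⟩, h3⟩, h4⟩
    have hle : ∀ x ∈ (l : Multiset ℕ), x ≤ n + 1 - k := fun x hx => by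
      have := add_numPos_le_sum_add_one (Multiset.mem_coe.1 hx)
      omega
    have hc : ∀ i : Fin (n + 1 - k), (l : Multiset ℕ).count ((i : ℕ) + 1) = α i := fun i => by
      rw [← h4, Multiset.coe_count]
    refine ⟨?_, h2⟩
    have h5 := h2.sum_eq (blockRise_zero a b)
    have h6 := Multiset.sum_map_eq_sum_fin hle (blockRise a b)
    simp only [hc, blockRise_zero, mul_zero, add_zero, Multiset.map_coe, Multiset.sum_coe] at h6
    have h7 : a * n + b * k - k = (l : Multiset ℕ).count 0 := by
      rw [Multiset.coe_count]; omega
    rw [eq_multisetOfCounts hle, h7]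
    congr 1
    exact funext hc

lemma card_arrangements_multisetOfCounts {a b : ℕ} (hab : a + b ≠ 0) {n k : ℕ} (hk : 1 ≤ k)
    {α : Fin (n + 1 - k) → ℕ} (hα : α ∈ bellIndices n k) :
    (arrangements (blockRise a b) 0 (multisetOfCounts (a * n + b * k - k) α)).card *
      ∏ i, (α i).factorial = (a * n + b * k).choose (k - 1) * (k - 1).factorial := by
  have hr := sum_blockRise_add hab hα
  obtain ⟨h1, h2⟩ := mem_bellIndices.1 hα
  set M := multisetOfCounts (a * n + b * k - k) α with hMdef
  have hle : ∀ x ∈ M, x ≤ n + 1 - k := fun x hx => le_of_mem_multisetOfCounts hx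
  have h3 := count_zero_succ_mul_card_arrangements (blockRise a b) (blockRise_zero a b) M 0 (by
    rw [Multiset.sum_map_eq_sum_fin hle, count_zero_multisetOfCounts, blockRise_zero]
    simp only [hMdef, count_succ_multisetOfCounts]
    omega)
  rw [Multiset.prod_factorial_count_eq hle, count_zero_multisetOfCounts,
    card_multisetOfCounts, h1, Nat.sub_add_cancel (by omega)] at h3
  simp only [hMdef, count_succ_multisetOfCounts] at h3
  have h4 := Nat.choose_mul_factorial_mul_factorial (n := a * n + b * k) (k := k - 1) (by omega)
  rw [show a * n + b * k - (k - 1) = a * n + b * k - k + 1 by omega, Nat.factorial_succ] at h4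
  -- With `z = a * n + b * k - k`, multiplying by `(z + 1) * z!` turns the right side into `(a * n +
  -- b * k)!`, the value given by the ballot theorem at height `0`.
  refine Nat.eq_of_mul_eq_mul_right
    (Nat.mul_pos (Nat.succ_pos (a * n + b * k - k)) (Nat.factorial_pos (a * n + b * k - k))) ?_
  rw [Nat.succ_eq_add_one, h4]
  linarith

lemma finite_blockIndexLists {a b : ℕ} (hab : a + b ≠ 0) (n : ℕ) :
    (blockIndexLists a b n).Finite :=
  have := finite_blockDyckWords a b n
  Finite.of_equiv _ (blockDyckWordsEquiv hab n).symm

open scoped Classical in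
lemma sum_colorings_eq_generalizedNarayana {a b : ℕ} (hab : a + b ≠ 0) (c : ℕ → ℕ) {n k : ℕ}
    (hk : 1 ≤ k) :
    ((∑ l ∈ (finite_blockIndexLists hab n).toFinset.filter (numPos · = k),
      colorings c l : ℕ) : ℚ) = generalizedNarayana a b c n k := by
  have hmap : ∀ l ∈ (finite_blockIndexLists hab n).toFinset.filter (numPos · = k),
      (fun i : Fin (n + 1 - k) => l.count ((i : ℕ) + 1)) ∈ bellIndices n k := by
    intro l hl
    simp only [Finset.mem_filter, Set.Finite.mem_toFinset] at hl
    obtain ⟨⟨h1, h2⟩, h3⟩ := hl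
    have hle : ∀ x ∈ (l : Multiset ℕ), x ≤ n + 1 - k := fun x hx => by
      have := add_numPos_le_sum_add_one (Multiset.mem_coe.1 hx)
      omega
    refine mem_bellIndices.2 ⟨?_, ?_⟩
    · refine Eq.trans ?_ h3
      rw [numPos_eq_sum, Multiset.sum_map_eq_sum_fin hle]
      simp
    · have := Multiset.sum_map_eq_sum_fin hle id
      simp only [id, Multiset.map_id', Multiset.sum_coe, mul_zero, add_zero,
        Multiset.coe_count] at this
      refine Eq.trans ?_ (this.symm.trans h1)
      exact Finset.sum_congr rfl fun i _ => mul_comm _ _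
  -- Group the lists by `α`; the coloring count is constant on each fibre.
  rw [← Finset.sum_fiberwise_of_maps_to hmap, generalizedNarayana, partialBell, Nat.cast_sum,
    Finset.mul_sum]
  refine Finset.sum_congr rfl fun α hα => ?_
  have hfib : ((finite_blockIndexLists hab n).toFinset.filter (numPos · = k)).filter
      (fun l => (fun i : Fin (n + 1 - k) => l.count ((i : ℕ) + 1)) = α) =
      arrangements (blockRise a b) 0 (multisetOfCounts (a * n + b * k - k) α) := by
    ext l
    rw [mem_arrangements_multisetOfCounts hab hα]
    simp
  have hcol : ∀ l ∈ arrangements (blockRise a b) 0 (multisetOfCounts (a * n + b * k - k) α),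
      colorings c l = ∏ i : Fin (n + 1 - k), c ((i : ℕ) + 1) ^ α i := by
    intro l hl
    rw [colorings_eq_prod, (mem_arrangements.1 hl).1,
      Multiset.prod_map_eq_prod_fin (fun x hx => le_of_mem_multisetOfCounts hx)]
    simp [count_succ_multisetOfCounts]
  rw [hfib, Finset.sum_congr rfl hcol, Finset.sum_const, smul_eq_mul]
  have hcard := card_arrangements_multisetOfCounts hab hk hα
  have hcard' := congrArg (Nat.cast : ℕ → ℚ) hcard
  push_cast at hcard' ⊢
  have hn : (n.factorial : ℚ) ≠ 0 := Nat.cast_ne_zero.2 n.factorial_ne_zero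
  have hP : (∏ i, ((α i).factorial : ℚ)) ≠ 0 :=
    Finset.prod_ne_zero_iff.2 fun i _ => Nat.cast_ne_zero.2 (α i).factorial_ne_zero
  have hx : ∀ i : Fin (n + 1 - k), ((((i : ℕ) + 1).factorial : ℚ) * (c ((i : ℕ) + 1) : ℚ)) /
      (((i : ℕ) + 1).factorial : ℚ) = c ((i : ℕ) + 1) := fun i =>
    mul_div_cancel_left₀ _ (Nat.cast_ne_zero.2 (Nat.factorial_ne_zero _))
  simp only [hx]
  rw [eq_div_of_mul_eq hP hcard']
  field_simp

/-! ### Colored paths and the theorem -/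

lemma card_colorings {a b : ℕ} (hab : a + b ≠ 0) (c : ℕ → ℕ) (js : List ℕ) :
    Nat.card ((i : Fin (ascentLengths (blockWord a b js)).length) →
      Fin (c ((ascentLengths (blockWord a b js)).get i / (a + b)))) = colorings c js := by
  rw [Nat.card_pi]
  simp only [Nat.card_fin]
  rw [← List.prod_ofFn, colorings]
  congr 1
  have : List.ofFn (fun i => c ((ascentLengths (blockWord a b js)).get i / (a + b))) =
      (List.ofFn (ascentLengths (blockWord a b js)).get).map (fun m => c (m / (a + b))) :=
    (List.map_ofFn (f := (ascentLengths (blockWord a b js)).get)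
      (g := fun m => c (m / (a + b)))).symm
  rw [this, List.ofFn_get, ascentLengths_blockWord hab, List.map_map]
  refine List.map_congr_left fun j _ => ?_
  simp [Nat.mul_div_cancel_left j (Nat.pos_of_ne_zero hab)]

open scoped Classical in
lemma card_coloredDyckPath_subtype {a b : ℕ} (hab : a + b ≠ 0) (c : ℕ → ℕ) (n : ℕ)
    (Q : ℕ → Prop) :
    Nat.card {p : ColoredDyckPath a b c n // Q p.peaks} =
      ∑ l ∈ (finite_blockIndexLists hab n).toFinset.filter (fun l => Q (numPos l)),
        colorings c l := by
  have := finite_blockDyckWords a b n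
  have e1 : {p : ColoredDyckPath a b c n // Q p.peaks} ≃
      (w : {w : blockDyckWords a b n // Q (numPeaks w.1.toList)}) ×
        ((i : Fin (ascentLengths w.1.1.toList).length) →
          Fin (c ((ascentLengths w.1.1.toList).get i / (a + b)))) :=
    Equiv.subtypeSigmaEquiv _ (fun w : blockDyckWords a b n => Q (numPeaks w.1.toList))
  have : Fintype {w : blockDyckWords a b n // Q (numPeaks w.1.toList)} := Fintype.ofFinite _
  rw [Nat.card_congr e1, Nat.card_sigma]
  symm
  have hpeaks (js : blockIndexLists a b n) :
      numPeaks (blockDyckWordsEquiv hab n js).1.toList = numPos js.1 := by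
    rw [blockDyckWordsEquiv_toList, numPeaks_blockWord hab, numPos]
  refine Finset.sum_bij (fun l hl =>
    have hl' := Finset.mem_filter.1 hl
    ⟨blockDyckWordsEquiv hab n ⟨l, (Set.Finite.mem_toFinset _).1 hl'.1⟩, by
      rw [hpeaks]; exact hl'.2⟩) ?_ ?_ ?_ ?_
  · exact fun _ _ => Finset.mem_univ _
  · intro l _ l' _ h
    exact congrArg Subtype.val ((blockDyckWordsEquiv hab n).injective (congrArg Subtype.val h))
  · rintro ⟨w, hw⟩ -
    obtain ⟨js, rfl⟩ := (blockDyckWordsEquiv hab n).surjective w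
    rw [hpeaks] at hw
    exact ⟨js.1, Finset.mem_filter.2 ⟨(Set.Finite.mem_toFinset _).2 js.2, hw⟩, rfl⟩
  · intro l _
    exact (card_colorings hab c l).symm

theorem mainTheorem3 (a b : ℕ) (hab : a + b ≠ 0) (c : ℕ → ℕ) (n : ℕ) (hn : 1 ≤ n) :
    Finite (ColoredDyckPath a b c n) ∧
    (Nat.card (ColoredDyckPath a b c n) : ℚ) =
      ∑ k ∈ Finset.Icc 1 n, generalizedNarayana a b c n k ∧
    ∀ k : ℕ, 1 ≤ k →
      (Nat.card {p : ColoredDyckPath a b c n // p.peaks = k} : ℚ) =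
        generalizedNarayana a b c n k := by
  classical
  refine ⟨?_, ?_, fun k hk => ?_⟩
  · have := finite_blockDyckWords a b n
    unfold ColoredDyckPath
    infer_instance
  · rw [← Nat.card_congr (Equiv.subtypeUnivEquiv (p := fun _ => True) fun _ => trivial),
      card_coloredDyckPath_subtype hab c n (fun _ => True), Finset.filter_true,
      ← Finset.sum_fiberwise_of_maps_to (g := numPos) (t := Finset.Icc 1 n), Nat.cast_sum]
    · exact Finset.sum_congr rfl fun k hk =>
        sum_colorings_eq_generalizedNarayana hab c (Finset.mem_Icc.1 hk).1
    -- Since `n ≥ 1`, some entry is positive, so no list has `k = 0`.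
    · intro l hl
      have hsum : l.sum = n := ((Set.Finite.mem_toFinset _).1 hl).1
      exact Finset.mem_Icc.2 ⟨numPos_pos (hsum ▸ hn), hsum ▸ numPos_le_sum l⟩
  · rw [card_coloredDyckPath_subtype hab c n (· = k)]
    convert sum_colorings_eq_generalizedNarayana hab c hk
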